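/- Let $\mathbf A\subset\mathbb R^2$ be a finite point set and let $\omega:\mathbf A\to\mathbb R$ be a height function; write $\mathbf p'=(\mathbf p,\omega(\mathbf p))\in\mathbb R^3$ and $\mathbf A^\omega=\{\mathbf p' : \mathbf p\in\mathbf A\}$. A triangulation of $\mathbf A$ is a geometric simplicial complex with vertices in $\mathbf A$ (not necessarily all of $\mathbf A$) whose underlying space is $\operatorname{conv}\mathbf A$. The lift $\mathcal T^\omega$ of a triangulation $\mathcal T$ consists of the simplices $\operatorname{conv}\{\mathbf p'_0,\dots,\mathbf p'_k\}$ with $\operatorname{conv}\{\mathbf p_0,\dots,\mathbf p_k\}\in\mathcal T$. The union $|\mathcal T^\omega|$ of its simplices is the graph of the function $g_{\mathcal T}:\operatorname{conv}\mathbf A\to\mathbb R$ that equals $\omega$ at the vertices of $\mathcal T$ and is affine on each simplex of $\mathcal T$. Let $\mathbf t\subset\mathbf A$ consist of four points, no three of them collinear, whose lifts span a non-degenerate tetrahedron $\operatorname{conv}\mathbf t'$. A triangulation $\mathcal T_2$ of $\mathbf A$ arises from a triangulation $\mathcal T_1$ by the up-flip with support $\mathbf t$ if $\mathcal T_1$ contains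 the projections to the plane of the lower facets of $\operatorname{conv}\mathbf t'$ and $\mathcal T_2$ is obtained from $\mathcal T_1$ by replacing these triangles and their faces by the projections of the upper facets and their faces, with nothing else changed; $\mathcal T_2$ arises from $\mathcal T_1$ by a down-flip if $\mathcal T_1$ arises from $\mathcal T_2$ by an up-flip. (In terms of triangles these are the 2-2, 1-3 and 3-1 flips.) A sequence of directed flips is monotone if all its flips are up-flips or all are down-flips. Let $\mathcal T_u,\mathcal T_v$ be triangulations of $\mathbf A$ such that $\mathcal T_u^\omega$ lies strictly lower than $\mathcal T_v^\omega$, that is, $g_{\mathcal T_u}\le g_{\mathcal T_v}$ everywhere and $g_{\mathcal T_u}\ne g_{\mathcal T_v}$. Put $$P_{uv}=\{(x,z)\in\mathbb R^2\times\mathbb R : x\in\operatorname{conv}\mathbf A,\ g_{\mathcal T_u}(x)\le z\le g_{\mathcal T_v}(x)\},$$ which is not assumed to be convex. Let $\mathcal T_u=\mathcal T_0,\mathcal T_1,\dots,\mathcal T_m=\mathcal T_v$ be any monotone sequence of directed flips, where $\mathcal T_{i+1}$ arises from $\mathcal T_i$ by a flip with support $\mathbf t_i$, $0\le i<m$. Then: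 1. The topological boundary of $P_{uv}$ in $\mathbb R^3$ is $|\mathcal T_u^\omega|\cup|\mathcal T_v^\omega|$. 2. The supports $\mathbf t_0,\dots,\mathbf t_{m-1}$ are pairwise distinct. 3. The simplices of all the lifted triangulations $\mathcal T_0^\omega,\dots,\mathcal T_m^\omega$, together with the tetrahedra $\operatorname{conv}\mathbf t_0',\dots,\operatorname{conv}\mathbf t_{m-1}'$, form a triangulation of $P_{uv}$: a geometric simplicial complex with vertices in $\mathbf A^\omega$ and underlying space $P_{uv}$. 4. The union of the tetrahedra $\operatorname{conv}\mathbf t_i'$ is the closure of the interior of $P_{uv}$. 5. If moreover $g_{\mathcal T_u}<g_{\mathcal T_v}$ on the interior of $\operatorname{conv}\mathbf A$, then every simplex of this triangulation is a face of one of the tetrahedra $\operatorname{conv}\mathbf t_i'$, and the union of these tetrahedra is $P_{uv}$. -/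

import Mathlib

noncomputable section

namespace DirectedFlips

/-- The plane `ℝ²`. The space `ℝ³` is taken as `ℝ² × ℝ`, the last coordinate being the height. -/
abbrev Plane : Type := EuclideanSpace ℝ (Fin 2)

/-- The geometric simplicial complex `K` has all its vertices in `V` and underlying space `X`.
Being a `Geometry.SimplicialComplex`, `K` has the closure and the intersection property (its empty
face is left implicit); the union property is `K.space = X`. -/
structure IsTriangulation {E : Type*} [AddCommGroup E] [Module ℝ E]
    (K : Geometry.SimplicialComplex ℝ E) (V X : Set E) : Prop where
  vertices_subset : K.vertices ⊆ V
  space_eq : K.space = X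

/-- `T` is a triangulation of the finite planar point set `A`: a simplicial complex whose vertices
belong to `A` (not all of `A` need occur) and whose underlying space is `conv A`. -/
def IsPlaneTriangulation (A : Finset Plane) (T : Geometry.SimplicialComplex ℝ Plane) : Prop :=
  IsTriangulation T (A : Set Plane) (convexHull ℝ (A : Set Plane))

/-! ### Lifting by a height function -/

/-- The lifting map `p ↦ p' = (p, ω p)`. -/
def lift (ω : Plane → ℝ) : Plane ↪ Plane × ℝ where
  toFun p := (p, ω p)
  inj' _ _ h := congrArg Prod.fst h

/-- The simplex (given by its vertices) in `ℝ³` spanned by the lifted vertices of `s`. -/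
def liftSimplex (ω : Plane → ℝ) (s : Finset Plane) : Finset (Plane × ℝ) := s.map (lift ω)

/-- The set of simplices of the lifted triangulation `T^ω`. -/
def liftedFaces (ω : Plane → ℝ) (T : Geometry.SimplicialComplex ℝ Plane) :
    Set (Finset (Plane × ℝ)) :=
  liftSimplex ω '' T.faces

/-- The union of the simplices of the lifted triangulation `T^ω`. It is the graph of the
characteristic section of `T`, i.e. of the piecewise-linear function on `conv A` that takes the
value `ω p` at every vertex `p` of `T` and is affine on every simplex of `T`. -/
def sectionGraph (ω : Plane → ℝ) (T : Geometry.SimplicialComplex ℝ Plane) : Set (Plane × ℝ) :=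
  ⋃ s ∈ liftedFaces ω T, convexHull ℝ (s : Set (Plane × ℝ))

/-- `T₁^ω` lies (weakly) lower than `T₂^ω`: the characteristic section of `T₁` is nowhere higher
than the one of `T₂`. -/
def LiesLower (ω : Plane → ℝ) (T₁ T₂ : Geometry.SimplicialComplex ℝ Plane) : Prop :=
  ∀ (x : Plane) (z₁ z₂ : ℝ),
    (x, z₁) ∈ sectionGraph ω T₁ → (x, z₂) ∈ sectionGraph ω T₂ → z₁ ≤ z₂

/-- `T₁^ω` lies strictly lower than `T₂^ω`: the strict part of the order `LiesLower`. -/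
def LiesStrictlyLower (ω : Plane → ℝ) (T₁ T₂ : Geometry.SimplicialComplex ℝ Plane) : Prop :=
  LiesLower ω T₁ T₂ ∧ ¬ LiesLower ω T₂ T₁

/-- The set of points of `ℝ³` that lie on or above the surface `T₁^ω` and on or below the surface
`T₂^ω`. -/
def regionBetween (ω : Plane → ℝ) (T₁ T₂ : Geometry.SimplicialComplex ℝ Plane) :
    Set (Plane × ℝ) :=
  {q | ∃ z₁ z₂ : ℝ, (q.1, z₁) ∈ sectionGraph ω T₁ ∧ (q.1, z₂) ∈ sectionGraph ω T₂ ∧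
    z₁ ≤ q.2 ∧ q.2 ≤ z₂}

/-! ### Directed flips -/

/-- For four points `t`, the triangle `f ⊆ t` lifts to a lower facet of `conv t'`: its three lifted
vertices lie on a non-vertical plane (the graph of `h`), and the remaining vertex is above it. -/
def IsLowerFacet (ω : Plane → ℝ) (t f : Finset Plane) : Prop :=
  f ⊆ t ∧ f.card = 3 ∧ ∃ h : Plane →ᵃ[ℝ] ℝ, (∀ p ∈ f, h p = ω p) ∧ ∀ p ∈ t, p ∉ f → h p < ω p

/-- For four points `t`, the triangle `f ⊆ t` lifts to an upper facet of `conv t'`. -/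
def IsUpperFacet (ω : Plane → ℝ) (t f : Finset Plane) : Prop :=
  f ⊆ t ∧ f.card = 3 ∧ ∃ h : Plane →ᵃ[ℝ] ℝ, (∀ p ∈ f, h p = ω p) ∧ ∀ p ∈ t, p ∉ f → ω p < h p

/-- The projections to the plane of the lower facets of `conv t'`, with all their faces. -/
def lowerFaces (ω : Plane → ℝ) (t : Finset Plane) : Set (Finset Plane) :=
  {s | s.Nonempty ∧ ∃ f, IsLowerFacet ω t f ∧ s ⊆ f}

/-- The projections to the plane of the upper facets of `conv t'`, with all their faces. -/
def upperFaces (ω : Plane → ℝ) (t : Finset Plane) : Set (Finset Plane) :=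
  {s | s.Nonempty ∧ ∃ f, IsUpperFacet ω t f ∧ s ⊆ f}

/-- `T₂` arises from `T₁` by the up-flip supported on the four points `t`. No three points of `t`
are collinear, so that `lowerFaces` and `upperFaces` are the two triangulations of `t`, with 2 and 2,
1 and 3, or 3 and 1 triangles; the lifted points span a (non-degenerate) tetrahedron; and the
flip replaces the lower faces of this tetrahedron by its upper faces, and changes nothing else. -/
structure IsUpFlip (ω : Plane → ℝ) (T₁ T₂ : Geometry.SimplicialComplex ℝ Plane)
    (t : Finset Plane) : Prop where
  card_eq : t.card = 4
  general_position : ∀ s ⊆ t, s.card = 3 → AffineIndependent ℝ ((↑) : s → Plane)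
  nondegenerate : AffineIndependent ℝ ((↑) : liftSimplex ω t → Plane × ℝ)
  lower_subset : lowerFaces ω t ⊆ T₁.faces
  upper_subset : upperFaces ω t ⊆ T₂.faces
  rest_eq : T₁.faces \ lowerFaces ω t = T₂.faces \ upperFaces ω t

/-- `T₂` arises from `T₁` by the down-flip supported on `t`: the upper faces of the tetrahedron are
in `T₁` and are replaced by the lower faces. -/
def IsDownFlip (ω : Plane → ℝ) (T₁ T₂ : Geometry.SimplicialComplex ℝ Plane)
    (t : Finset Plane) : Prop :=
  IsUpFlip ω T₂ T₁ t

/-- `T 0, …, T m` is a sequence of triangulations of `A`, in which `T (i + 1)` arises from `T i` by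
a directed flip with support `t i ⊆ A` (for `i < m`), all flips having the same direction. The
values `T i` for `i > m` and `t i` for `i ≥ m` play no role. -/
structure IsMonotoneFlipSequence (A : Finset Plane) (ω : Plane → ℝ) (m : ℕ)
    (T : ℕ → Geometry.SimplicialComplex ℝ Plane) (t : ℕ → Finset Plane) : Prop where
  triangulation : ∀ i ≤ m, IsPlaneTriangulation A (T i)
  support_subset : ∀ i < m, t i ⊆ A
  monotone : (∀ i < m, IsUpFlip ω (T i) (T (i + 1)) (t i)) ∨
    (∀ i < m, IsDownFlip ω (T i) (T (i + 1)) (t i))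

/-- The simplices swept out by a flip sequence: all simplices of the lifted triangulations
`(T i)^ω`, `i ≤ m`, and the tetrahedra spanned by the lifted supports `t i`, `i < m`. -/
def sweptFaces (ω : Plane → ℝ) (m : ℕ) (T : ℕ → Geometry.SimplicialComplex ℝ Plane)
    (t : ℕ → Finset Plane) : Set (Finset (Plane × ℝ)) :=
  {s | (∃ i ≤ m, s ∈ liftedFaces ω (T i)) ∨ ∃ i < m, s = liftSimplex ω (t i)}

end DirectedFlips

end

namespace DirectedFlips

open Finset Module Geometry

/-! ### Affinely independent finite sets -/

/-! An up-flip pushes the section `height ω T` upwards across one tetrahedron: the tetrahedron lies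
between the old and the new section, and wherever the two differ, the vertical segment between them
lies in it. Strictness excludes down-flips, so the sections rise monotonically from `T 0` to `T m`,
and the tetrahedra are stacked one above the other and fill the solid.

The local picture comes from the single affine dependence `l` of the four support points
(`IsUpFlip.exists_circuit`): all its coefficients are nonzero and it lifts to the vertical unit
vector. The facet opposite `p` is lower or upper according to the sign of `l p`, and moving along
`l` leads from any point of the tetrahedron to its lower or upper surface.

Globally, simplices are compared through carriers, the faces containing a point in their relative
interior. If the sections of `T i` and `T j` agree at a point, so do all sections between them, and
the carrier survives every flip (`mem_faces_iff_of_height_eq`). Two swept simplices meet only where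
heights are squeezed in this way, which reduces the intersection property to that of one planar
complex. Boundary and interior follow from compactness of the sections and from the nonempty
interiors of the tetrahedra; the last claim adds a density argument (`exists_support_superset`). -/

theorem affineIndependent_coe_iff {E : Type*} [AddCommGroup E] [Module ℝ E] (s : Finset E) :
    AffineIndependent ℝ ((↑) : s → E) ↔
      ∀ w : E → ℝ, ∑ p ∈ s, w p = 0 → ∑ p ∈ s, w p • p = 0 → ∀ p ∈ s, w p = 0 := by
  classical
  constructor
  · intro h w h0 h1 p hp
    refine affineIndependent_iff.1 h univ (fun q => w q) ?_ ?_ ⟨p, hp⟩ (mem_univ _)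
    · rwa [Finset.sum_coe_sort s w]
    · rwa [Finset.sum_coe_sort s fun q => w q • q]
  · intro h
    rw [affineIndependent_iff_of_fintype]
    intro w h0 h1 i
    rw [Finset.weightedVSub_eq_linear_combination _ h0] at h1
    have := h (fun e => if he : e ∈ s then w ⟨e, he⟩ else 0) ?_ ?_ i i.2
    · simpa using this
    · rw [← Finset.sum_coe_sort s]; simpa using h0
    · rw [← Finset.sum_coe_sort s]; simpa using h1

theorem weights_unique {E : Type*} [AddCommGroup E] [Module ℝ E] {s : Finset E}
    (h : AffineIndependent ℝ ((↑) : s → E)) {w v : E → ℝ}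
    (hsum : ∑ p ∈ s, w p = ∑ p ∈ s, v p) (hcomb : ∑ p ∈ s, w p • p = ∑ p ∈ s, v p • p) :
    ∀ p ∈ s, w p = v p := by
  intro p hp
  refine sub_eq_zero.1 ((affineIndependent_coe_iff s).1 h (fun q => w q - v q) ?_ ?_ p hp)
  · simp [hsum]
  · simp [sub_smul, hcomb]

/-- A point with positive barycentric coordinates in a simplex lies in no proper face. -/
theorem subset_of_pos_weights {E : Type*} [AddCommGroup E] [Module ℝ E] {s : Finset E}
    (h : AffineIndependent ℝ ((↑) : s → E)) {w : E → ℝ} (hpos : ∀ p ∈ s, 0 < w p)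
    (hsum : ∑ p ∈ s, w p = 1) {c : Set E} (hc : c ⊆ s)
    (hx : ∑ p ∈ s, w p • p ∈ convexHull ℝ c) : (s : Set E) ⊆ c := by
  classical
  lift c to Finset E using s.finite_toSet.subset hc
  obtain ⟨v, -, hv1, hvx⟩ := Finset.mem_convexHull'.1 hx
  have hcs : c ⊆ s := by exact_mod_cast hc
  have key := weights_unique h (w := w) (v := fun p => if p ∈ c then v p else 0) ?_ ?_
  · intro p hp
    by_contra hpc
    have := key p hp
    rw [if_neg (by exact_mod_cast hpc)] at this
    exact (hpos p hp).ne' this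
  · rw [hsum, ← hv1, Finset.sum_ite_mem, Finset.inter_eq_right.2 hcs]
  · simp only [ite_smul, zero_smul]
    rw [← hvx, Finset.sum_ite_mem, Finset.inter_eq_right.2 hcs]

theorem pos_weights_mem_interior {E : Type*} [NormedAddCommGroup E] [NormedSpace ℝ E]
    {s : Finset E} (h : AffineIndependent ℝ ((↑) : s → E)) (htop : affineSpan ℝ (s : Set E) = ⊤)
    {w : E → ℝ} (hpos : ∀ p ∈ s, 0 < w p) (hsum : ∑ p ∈ s, w p = 1) :
    ∑ p ∈ s, w p • p ∈ interior (convexHull ℝ (s : Set E)) := by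
  let b : AffineBasis s ℝ E := ⟨(↑), h, by simpa using htop⟩
  have hr : Set.range b = (s : Set E) := Subtype.range_coe
  rw [← hr, b.interior_convexHull]
  intro i
  have h1 : ∑ q : s, w q = 1 := by rwa [Finset.sum_coe_sort s w]
  have h2 : ∑ p ∈ s, w p • p = univ.affineCombination ℝ b fun q : s => w q := by
    rw [Finset.affineCombination_eq_linear_combination _ _ _ h1]
    exact (Finset.sum_coe_sort s fun q => w q • q).symm
  rw [h2, b.coord_apply_combination_of_mem (mem_univ i) h1]
  exact hpos i i.2

/-! ### Lifted simplices -/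

variable {ω : Plane → ℝ}

theorem lift_apply (ω : Plane → ℝ) (p : Plane) : lift ω p = (p, ω p) := rfl

/-- Transporting weights along `lift` lets one weight function on the plane control both the
projection and the height. -/
theorem mem_convexHull_liftSimplex {s : Finset Plane} {x : Plane} {z : ℝ} :
    (x, z) ∈ convexHull ℝ (liftSimplex ω s : Set (Plane × ℝ)) ↔
      ∃ w : Plane → ℝ, (∀ p ∈ s, 0 ≤ w p) ∧ ∑ p ∈ s, w p = 1 ∧ ∑ p ∈ s, w p • p = x ∧
        ∑ p ∈ s, w p * ω p = z := by
  rw [Finset.mem_convexHull', liftSimplex]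
  simp only [Finset.sum_map, Finset.mem_map, forall_exists_index, and_imp,
    forall_apply_eq_imp_iff₂]
  constructor
  · rintro ⟨w, h0, h1, h2⟩
    refine ⟨fun p => w (lift ω p), h0, h1, ?_, ?_⟩
    · simpa [Prod.fst_sum, lift_apply] using congrArg Prod.fst h2
    · simpa [Prod.snd_sum, lift_apply] using congrArg Prod.snd h2
  · rintro ⟨w, h0, h1, h2, h3⟩
    refine ⟨fun q => w q.1, fun p hp => h0 p hp, h1, ?_⟩
    ext1
    · simpa [Prod.fst_sum, lift_apply] using h2
    · simpa [Prod.snd_sum, lift_apply] using h3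

/-- `(x, z)` lies in the relative interior of the lift of the simplex `s`. -/
def InRelInterior (ω : Plane → ℝ) (s : Finset Plane) (x : Plane) (z : ℝ) : Prop :=
  ∃ w : Plane → ℝ, (∀ p ∈ s, 0 < w p) ∧ ∑ p ∈ s, w p = 1 ∧ ∑ p ∈ s, w p • p = x ∧
    ∑ p ∈ s, w p * ω p = z

theorem InRelInterior.mem {s : Finset Plane} {x : Plane} {z : ℝ} (h : InRelInterior ω s x z) :
    (x, z) ∈ convexHull ℝ (liftSimplex ω s : Set (Plane × ℝ)) := by
  obtain ⟨w, h0, h⟩ := h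
  exact mem_convexHull_liftSimplex.2 ⟨w, fun p hp => (h0 p hp).le, h⟩

/-- Discarding the vertices of weight zero leaves the carrier. -/
theorem exists_carrier {s : Finset Plane} {x : Plane} {z : ℝ}
    (h : (x, z) ∈ convexHull ℝ (liftSimplex ω s : Set (Plane × ℝ))) :
    ∃ r ⊆ s, r.Nonempty ∧ InRelInterior ω r x z := by
  classical
  obtain ⟨w, h0, h1, h2, h3⟩ := mem_convexHull_liftSimplex.1 h
  have hz : ∀ p ∈ s, p ∉ s.filter (fun p => 0 < w p) → w p = 0 := fun p hp hpn =>
    le_antisymm (not_lt.1 fun hlt => hpn (mem_filter.2 ⟨hp, hlt⟩)) (h0 p hp)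
  have h1' : ∑ p ∈ s.filter (fun p => 0 < w p), w p = 1 := by
    rw [← h1]; exact Finset.sum_subset (filter_subset _ _) hz
  refine ⟨s.filter fun p => 0 < w p, filter_subset _ _, ?_, w, fun p hp => (mem_filter.1 hp).2,
    h1', ?_, ?_⟩
  · exact Finset.nonempty_of_sum_ne_zero (by rw [h1']; exact one_ne_zero)
  · rw [← h2]
    exact Finset.sum_subset (filter_subset _ _) fun p hp hpn => by rw [hz p hp hpn, zero_smul]
  · rw [← h3]
    exact Finset.sum_subset (filter_subset _ _) fun p hp hpn => by rw [hz p hp hpn, zero_mul]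

theorem exists_mem_convexHull_liftSimplex {s : Finset Plane} {x : Plane} :
    x ∈ convexHull ℝ (s : Set Plane) ↔
      ∃ z, (x, z) ∈ convexHull ℝ (liftSimplex ω s : Set (Plane × ℝ)) := by
  constructor
  · intro h
    obtain ⟨w, h0, h1, h2⟩ := Finset.mem_convexHull'.1 h
    exact ⟨_, mem_convexHull_liftSimplex.2 ⟨w, h0, h1, h2, rfl⟩⟩
  · rintro ⟨z, h⟩
    obtain ⟨w, h0, h1, h2, -⟩ := mem_convexHull_liftSimplex.1 h
    exact Finset.mem_convexHull'.2 ⟨w, h0, h1, h2⟩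

theorem liftSimplex_mono {s r : Finset Plane} (h : s ⊆ r) : liftSimplex ω s ⊆ liftSimplex ω r :=
  Finset.map_subset_map.2 h

theorem convexHull_liftSimplex_mono {s r : Finset Plane} (h : s ⊆ r) :
    convexHull ℝ (liftSimplex ω s : Set (Plane × ℝ)) ⊆ convexHull ℝ (liftSimplex ω r) :=
  convexHull_mono (by exact_mod_cast liftSimplex_mono h)

theorem affineIndependent_liftSimplex_iff {s : Finset Plane} :
    AffineIndependent ℝ ((↑) : liftSimplex ω s → Plane × ℝ) ↔
      ∀ w : Plane → ℝ, ∑ p ∈ s, w p = 0 → ∑ p ∈ s, w p • p = 0 → ∑ p ∈ s, w p * ω p = 0 →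
        ∀ p ∈ s, w p = 0 := by
  rw [affineIndependent_coe_iff]
  simp only [liftSimplex, Finset.sum_map, Finset.mem_map, forall_exists_index, and_imp,
    forall_apply_eq_imp_iff₂]
  constructor
  · intro h w h0 h1 h2
    refine h (fun q => w q.1) h0 ?_
    ext1
    · simpa [Prod.fst_sum, lift_apply] using h1
    · simpa [Prod.snd_sum, lift_apply] using h2
  · intro h w h0 h1
    refine h (fun p => w (lift ω p)) h0 ?_ ?_
    · simpa [Prod.fst_sum, lift_apply] using congrArg Prod.fst h1
    · simpa [Prod.snd_sum, lift_apply] using congrArg Prod.snd h1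

theorem affineIndependent_liftSimplex {s : Finset Plane}
    (h : AffineIndependent ℝ ((↑) : s → Plane)) :
    AffineIndependent ℝ ((↑) : liftSimplex ω s → Plane × ℝ) :=
  affineIndependent_liftSimplex_iff.2 fun w h0 h1 _ => (affineIndependent_coe_iff s).1 h w h0 h1

theorem InRelInterior.mem_interior {s : Finset Plane} {x : Plane} {z : ℝ}
    (hs : AffineIndependent ℝ ((↑) : liftSimplex ω s → Plane × ℝ))
    (htop : affineSpan ℝ (liftSimplex ω s : Set (Plane × ℝ)) = ⊤) (h : InRelInterior ω s x z) :
    (x, z) ∈ interior (convexHull ℝ (liftSimplex ω s : Set (Plane × ℝ))) := by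
  obtain ⟨w, h0, h1, rfl, rfl⟩ := h
  have key := pos_weights_mem_interior hs htop (w := fun q => w q.1)
    (by simpa [liftSimplex, lift_apply] using h0) (by simpa [liftSimplex, lift_apply] using h1)
  convert key
  · simp [liftSimplex, lift_apply, Prod.fst_sum]
  · simp [liftSimplex, lift_apply, Prod.snd_sum]

/-- In a lifted simplex with affinely independent vertices, a face meeting the relative interior of
another one contains it. -/
theorem InRelInterior.subset_of_subset {t s r : Finset Plane} {x : Plane} {z : ℝ}
    (ht : AffineIndependent ℝ ((↑) : liftSimplex ω t → Plane × ℝ)) (hs : s ⊆ t) (hr : r ⊆ t)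
    (h : InRelInterior ω s x z)
    (hx : (x, z) ∈ convexHull ℝ (liftSimplex ω r : Set (Plane × ℝ))) : s ⊆ r := by
  classical
  obtain ⟨w, h0, h1, h2, h3⟩ := h
  obtain ⟨v, k0, k1, k2, k3⟩ := mem_convexHull_liftSimplex.1 hx
  intro p hp
  by_contra hpr
  -- The two barycentric representations, extended by zero to `t`, differ by an affine dependence of
  -- the lifted points; at a vertex of `s` outside `r` its coefficient would be `w p > 0`.
  have := affineIndependent_liftSimplex_iff.1 ht
    (fun q => (if q ∈ s then w q else 0) - if q ∈ r then v q else 0) ?_ ?_ ?_ p (hs hp)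
  · simp only [if_pos hp, if_neg hpr, sub_zero] at this
    exact (h0 p hp).ne' this
  · simp [Finset.sum_sub_distrib, Finset.sum_ite_mem, Finset.inter_eq_right.2 hs,
      Finset.inter_eq_right.2 hr, h1, k1]
  · simp [sub_smul, ite_smul, Finset.sum_sub_distrib, Finset.sum_ite_mem,
      Finset.inter_eq_right.2 hs, Finset.inter_eq_right.2 hr, h2, k2]
  · simp [sub_mul, ite_mul, Finset.sum_sub_distrib, Finset.sum_ite_mem,
      Finset.inter_eq_right.2 hs, Finset.inter_eq_right.2 hr, h3, k3]

/-! ### Sections over a simplicial complex -/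

/-- In a simplicial complex, a face that meets the relative interior of another face contains it. -/
theorem InRelInterior.subset_of_mem_faces {T : SimplicialComplex ℝ Plane} {s r : Finset Plane}
    {x : Plane} {z : ℝ} (h : InRelInterior ω s x z) (hs : s ∈ T.faces) (hr : r ∈ T.faces)
    (hx : x ∈ convexHull ℝ (r : Set Plane)) : s ⊆ r := by
  have hxs := exists_mem_convexHull_liftSimplex.2 ⟨z, h.mem⟩
  obtain ⟨w, h0, h1, rfl, -⟩ := h
  have := subset_of_pos_weights (T.indep hs) h0 h1 (Set.inter_subset_left (t := (r : Set Plane)))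
    (T.inter_subset_convexHull hs hr ⟨hxs, hx⟩)
  exact fun p hp => (this hp).2

theorem mem_sectionGraph {T : SimplicialComplex ℝ Plane} {q : Plane × ℝ} :
    q ∈ sectionGraph ω T ↔
      ∃ s ∈ T.faces, q ∈ convexHull ℝ (liftSimplex ω s : Set (Plane × ℝ)) := by
  simp [sectionGraph, liftedFaces]

theorem exists_carrier_mem_faces {T : SimplicialComplex ℝ Plane} {x : Plane} {z : ℝ}
    (h : (x, z) ∈ sectionGraph ω T) : ∃ s ∈ T.faces, InRelInterior ω s x z := by
  obtain ⟨s, hs, hx⟩ := mem_sectionGraph.1 h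
  obtain ⟨r, hrs, hr, hc⟩ := exists_carrier hx
  exact ⟨r, T.down_closed hs hrs hr, hc⟩

/-- Both points have the same carrier over `x`, and barycentric coordinates in it are determined by
`x` alone. -/
theorem eq_of_mem_sectionGraph {T : SimplicialComplex ℝ Plane} {x : Plane} {z₁ z₂ : ℝ}
    (h₁ : (x, z₁) ∈ sectionGraph ω T) (h₂ : (x, z₂) ∈ sectionGraph ω T) : z₁ = z₂ := by
  obtain ⟨s, hs, hcs⟩ := exists_carrier_mem_faces h₁
  obtain ⟨r, hr, hcr⟩ := exists_carrier_mem_faces h₂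
  have hsr : s = r := (hcs.subset_of_mem_faces hs hr
    (exists_mem_convexHull_liftSimplex.2 ⟨_, hcr.mem⟩)).antisymm (hcr.subset_of_mem_faces hr hs
    (exists_mem_convexHull_liftSimplex.2 ⟨_, hcs.mem⟩))
  subst hsr
  obtain ⟨w, -, w1, w2, rfl⟩ := hcs
  obtain ⟨v, -, v1, v2, rfl⟩ := hcr
  exact Finset.sum_congr rfl fun p hp => by
    rw [weights_unique (T.indep hs) (w1.trans v1.symm) (w2.trans v2.symm) p hp]

/-- The value at `x` of the characteristic section of `T`. -/
noncomputable def height (ω : Plane → ℝ) (T : SimplicialComplex ℝ Plane) (x : Plane) : ℝ :=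
  -- Off `T.space` the value is arbitrary, hence the membership condition in `mem_sectionGraph_iff`.
  Classical.epsilon fun z => (x, z) ∈ sectionGraph ω T

theorem mem_sectionGraph_iff {T : SimplicialComplex ℝ Plane} {x : Plane} {z : ℝ} :
    (x, z) ∈ sectionGraph ω T ↔ x ∈ T.space ∧ z = height ω T x := by
  have key : x ∈ T.space → (x, height ω T x) ∈ sectionGraph ω T := by
    intro h
    obtain ⟨s, hs, hx⟩ := SimplicialComplex.mem_space_iff.1 h
    obtain ⟨z, hz⟩ := (exists_mem_convexHull_liftSimplex (ω := ω)).1 hx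
    exact Classical.epsilon_spec (p := fun z => (x, z) ∈ sectionGraph ω T)
      ⟨z, mem_sectionGraph.2 ⟨s, hs, hz⟩⟩
  constructor
  · intro h
    obtain ⟨s, hs, hx⟩ := mem_sectionGraph.1 h
    have hsp : x ∈ T.space :=
      SimplicialComplex.mem_space_iff.2 ⟨s, hs, exists_mem_convexHull_liftSimplex.2 ⟨z, hx⟩⟩
    exact ⟨hsp, eq_of_mem_sectionGraph h (key hsp)⟩
  · rintro ⟨h, rfl⟩
    exact key h

theorem height_eq_of_mem {T : SimplicialComplex ℝ Plane} {s : Finset Plane} {x : Plane} {z : ℝ}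
    (hs : s ∈ T.faces) (h : (x, z) ∈ convexHull ℝ (liftSimplex ω s : Set (Plane × ℝ))) :
    height ω T x = z :=
  (mem_sectionGraph_iff.1 (mem_sectionGraph.2 ⟨s, hs, h⟩)).2.symm

theorem liesLower_iff {T₁ T₂ : SimplicialComplex ℝ Plane} (h : T₁.space = T₂.space) :
    LiesLower ω T₁ T₂ ↔ ∀ x ∈ T₁.space, height ω T₁ x ≤ height ω T₂ x := by
  simp only [LiesLower, mem_sectionGraph_iff, ← h]
  grind

theorem mem_regionBetween_iff {T₁ T₂ : SimplicialComplex ℝ Plane} (h : T₁.space = T₂.space)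
    {x : Plane} {z : ℝ} : (x, z) ∈ regionBetween ω T₁ T₂ ↔
      x ∈ T₁.space ∧ height ω T₁ x ≤ z ∧ z ≤ height ω T₂ x := by
  simp only [regionBetween, Set.mem_ofPred_eq, mem_sectionGraph_iff, ← h]
  grind

/-! ### The tetrahedron of a flip -/

/-- Moving a point of a simplex in the direction of an affine dependence `l` until it leaves. -/
theorem exists_erase_mem {t : Finset Plane} {l : Plane → ℝ} (l0 : ∑ p ∈ t, l p = 0)
    (l1 : ∑ p ∈ t, l p • p = 0) (lpos : ∃ p ∈ t, 0 < l p) {x : Plane} {z : ℝ}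
    (h : (x, z) ∈ convexHull ℝ (liftSimplex ω t : Set (Plane × ℝ))) :
    ∃ p ∈ t, 0 < l p ∧ ∃ c : ℝ, 0 ≤ c ∧ (x, z - c * ∑ p ∈ t, l p * ω p) ∈
      convexHull ℝ (liftSimplex ω (t.erase p) : Set (Plane × ℝ)) := by
  obtain ⟨w, h0, h1, h2, h3⟩ := mem_convexHull_liftSimplex.1 h
  -- Ratio test: the least `w p / l p` over positive `l p` is the largest step that keeps all
  -- weights nonnegative, and it makes the weight at `p` vanish.
  obtain ⟨p, hp, hmin⟩ := Finset.exists_min_image (t.filter fun p => 0 < l p) (fun p => w p / l p)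
    (by obtain ⟨p, hp, h⟩ := lpos; exact ⟨p, mem_filter.2 ⟨hp, h⟩⟩)
  obtain ⟨hpt, hlp⟩ := mem_filter.1 hp
  have hc : 0 ≤ w p / l p := div_nonneg (h0 p hpt) hlp.le
  refine ⟨p, hpt, hlp, w p / l p, hc, mem_convexHull_liftSimplex.2
    ⟨fun q => w q - w p / l p * l q, fun q hq => ?_, ?_, ?_, ?_⟩⟩
  · have hqt := mem_of_mem_erase hq
    rcases le_or_gt (l q) 0 with hl | hl
    · exact sub_nonneg.2 ((mul_nonpos_of_nonneg_of_nonpos hc hl).trans (h0 q hqt))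
    · exact sub_nonneg.2 ((le_div_iff₀ hl).1 (hmin q (mem_filter.2 ⟨hqt, hl⟩)))
  · rw [Finset.sum_erase _ (by field_simp; ring), Finset.sum_sub_distrib, ← Finset.mul_sum, l0, h1]
    ring
  · rw [Finset.sum_erase _ (by simp [div_mul_cancel₀ _ hlp.ne'])]
    simp only [sub_smul, mul_smul, Finset.sum_sub_distrib, ← Finset.smul_sum, l1, h2]
    simp
  · rw [Finset.sum_erase _ (by simp [div_mul_cancel₀ _ hlp.ne'])]
    simp only [sub_mul, Finset.sum_sub_distrib, h3, mul_assoc, ← Finset.mul_sum]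

/-- Some affine function interpolates `ω` on three affinely independent points of the plane. -/
theorem exists_affineMap_interpolating (ω : Plane → ℝ) {f : Finset Plane} (hf : f.card = 3)
    (hi : AffineIndependent ℝ ((↑) : f → Plane)) :
    ∃ h : Plane →ᵃ[ℝ] ℝ, ∀ p ∈ f, h p = ω p := by
  classical
  have htop : affineSpan ℝ (Set.range ((↑) : f → Plane)) = ⊤ := by
    rw [hi.affineSpan_eq_top_iff_card_eq_finrank_add_one]
    simp [hf]
  let b : AffineBasis f ℝ Plane := ⟨(↑), hi, htop⟩
  refine ⟨∑ q : f, ω q • b.coord q, fun p hp => ?_⟩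
  have : ∀ (s : Finset f), (∑ q ∈ s, ω q • b.coord q) p = ∑ q ∈ s, ω q * b.coord q p := by
    intro s
    induction s using Finset.induction_on with
    | empty => simp
    | insert a s ha ih => rw [Finset.sum_insert ha, Finset.sum_insert ha, ← ih]; simp
  rw [this, Finset.sum_eq_single ⟨p, hp⟩]
  · have : b.coord ⟨p, hp⟩ p = 1 := b.coord_apply_eq ⟨p, hp⟩
    simp [this]
  · intro q _ hq
    have : b.coord q p = 0 := b.coord_apply_ne (i := q) (j := ⟨p, hp⟩) hq
    simp [this]
  · simp

/-- Affine maps respect affine dependences. -/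
theorem sum_mul_affineMap_eq_zero {t : Finset Plane} {l : Plane → ℝ} (l0 : ∑ p ∈ t, l p = 0)
    (l1 : ∑ p ∈ t, l p • p = 0) (h : Plane →ᵃ[ℝ] ℝ) : ∑ p ∈ t, l p * h p = 0 := by
  have : ∀ p, h p = h.linear p + h 0 := fun p => congrFun h.decomp p
  rw [Finset.sum_congr rfl fun p _ => by rw [this p, mul_add], Finset.sum_add_distrib,
    ← Finset.sum_mul, l0, zero_mul, add_zero]
  simpa using congrArg h.linear l1

/-- The affine dependence of the support of a flip, normalized to rise by `1` vertically. -/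
theorem IsUpFlip.exists_circuit {T₁ T₂ : SimplicialComplex ℝ Plane} {t : Finset Plane}
    (hf : IsUpFlip ω T₁ T₂ t) :
    ∃ l : Plane → ℝ, ∑ p ∈ t, l p = 0 ∧ ∑ p ∈ t, l p • p = 0 ∧ ∑ p ∈ t, l p * ω p = 1 ∧
      ∀ p ∈ t, l p ≠ 0 := by
  obtain ⟨f, f1, f0, p, hp, hfp⟩ :=
    Module.exists_nontrivial_relation_sum_zero_of_finrank_succ_lt_card (R := ℝ) (t := t)
      (by simp [hf.card_eq])
  -- A zero coefficient would leave a nontrivial dependence among three non-collinear points.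
  have hne : ∀ q ∈ t, f q ≠ 0 := by
    intro q hq h0
    have hi := (affineIndependent_coe_iff _).1 (hf.general_position (t.erase q) (erase_subset _ _)
      (by rw [card_erase_of_mem hq, hf.card_eq])) f (by rwa [Finset.sum_erase _ h0])
      (by rwa [Finset.sum_erase _ (by rw [h0, zero_smul])])
    rcases eq_or_ne p q with rfl | hpq
    · exact hfp h0
    · exact hfp (hi p (mem_erase.2 ⟨hpq, hp⟩))
  have hω : ∑ p ∈ t, f p * ω p ≠ 0 := by
    intro h0
    exact hne p hp (affineIndependent_liftSimplex_iff.1 hf.nondegenerate f f0 f1 h0 p hp)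
  refine ⟨fun p => (∑ p ∈ t, f p * ω p)⁻¹ * f p, ?_, ?_, ?_, fun q hq =>
    mul_ne_zero (inv_ne_zero hω) (hne q hq)⟩
  · rw [← Finset.mul_sum, f0, mul_zero]
  · simp only [mul_smul, ← Finset.smul_sum, f1, smul_zero]
  · simp only [mul_assoc, ← Finset.mul_sum]
    exact inv_mul_cancel₀ hω

section Facets

variable {T₁ T₂ : SimplicialComplex ℝ Plane} {t : Finset Plane} {l : Plane → ℝ} {p : Plane}

/-- The dependence annihilates the affine function `h`, so on `ω - h` only the term at `p` remains.
The sign of `l p` thus tells on which side of the plane through the opposite facet the lift of `p`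
lies. -/
theorem IsUpFlip.exists_interpolation (hf : IsUpFlip ω T₁ T₂ t) (l0 : ∑ p ∈ t, l p = 0)
    (l1 : ∑ p ∈ t, l p • p = 0) (lω : ∑ p ∈ t, l p * ω p = 1) (hp : p ∈ t) :
    (t.erase p).card = 3 ∧ ∃ h : Plane →ᵃ[ℝ] ℝ, (∀ q ∈ t.erase p, h q = ω q) ∧
      l p * (ω p - h p) = 1 := by
  have hc : (t.erase p).card = 3 := by rw [card_erase_of_mem hp, hf.card_eq]
  obtain ⟨h, hh⟩ := exists_affineMap_interpolating ω hc
    (hf.general_position _ (erase_subset _ _) hc)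
  refine ⟨hc, h, hh, ?_⟩
  have h1 := sum_mul_affineMap_eq_zero l0 l1 h
  rw [← Finset.add_sum_erase _ _ hp] at h1 lω
  rw [Finset.sum_congr rfl fun q hq => by rw [hh q hq]] at h1
  linarith

theorem IsUpFlip.isLowerFacet_erase (hf : IsUpFlip ω T₁ T₂ t) (l0 : ∑ p ∈ t, l p = 0)
    (l1 : ∑ p ∈ t, l p • p = 0) (lω : ∑ p ∈ t, l p * ω p = 1) (hp : p ∈ t) (hl : 0 < l p) :
    IsLowerFacet ω t (t.erase p) := by
  obtain ⟨hc, h, hh, h1⟩ := hf.exists_interpolation l0 l1 lω hp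
  refine ⟨erase_subset _ _, hc, h, hh, fun q hq hqe => ?_⟩
  obtain rfl : q = p := by_contra fun hne => hqe (mem_erase.2 ⟨hne, hq⟩)
  exact sub_pos.1 (pos_of_mul_pos_right (h1 ▸ one_pos) hl.le)

theorem IsUpFlip.isUpperFacet_erase (hf : IsUpFlip ω T₁ T₂ t) (l0 : ∑ p ∈ t, l p = 0)
    (l1 : ∑ p ∈ t, l p • p = 0) (lω : ∑ p ∈ t, l p * ω p = 1) (hp : p ∈ t) (hl : l p < 0) :
    IsUpperFacet ω t (t.erase p) := by
  obtain ⟨hc, h, hh, h1⟩ := hf.exists_interpolation l0 l1 lω hp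
  refine ⟨erase_subset _ _, hc, h, hh, fun q hq hqe => ?_⟩
  obtain rfl : q = p := by_contra fun hne => hqe (mem_erase.2 ⟨hne, hq⟩)
  nlinarith

theorem IsLowerFacet.mem_lowerFaces {f : Finset Plane} (h : IsLowerFacet ω t f) :
    f ∈ lowerFaces ω t :=
  ⟨card_pos.1 (by rw [h.2.1]; norm_num), f, h, Subset.rfl⟩

theorem IsUpperFacet.mem_upperFaces {f : Finset Plane} (h : IsUpperFacet ω t f) :
    f ∈ upperFaces ω t :=
  ⟨card_pos.1 (by rw [h.2.1]; norm_num), f, h, Subset.rfl⟩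

/-- Below every point of the tetrahedron there is a point of the lower surface. -/
theorem IsUpFlip.exists_lower (hf : IsUpFlip ω T₁ T₂ t) {x : Plane} {z : ℝ}
    (h : (x, z) ∈ convexHull ℝ (liftSimplex ω t : Set (Plane × ℝ))) :
    ∃ f ⊆ t, f ∈ T₁.faces ∧ ∃ z₀ ≤ z,
      (x, z₀) ∈ convexHull ℝ (liftSimplex ω f : Set (Plane × ℝ)) := by
  obtain ⟨l, l0, l1, lω, hl⟩ := hf.exists_circuit
  have ht : ∃ i ∈ t, l i ≠ 0 := by
    obtain ⟨p, hp⟩ := card_pos.1 (hf.card_eq ▸ four_pos : 0 < t.card)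
    exact ⟨p, hp, hl p hp⟩
  obtain ⟨p, hp, hlp, c, hc, hm⟩ := exists_erase_mem l0 l1
    (Finset.exists_pos_of_sum_zero_of_exists_nonzero l l0 ht) h
  refine ⟨t.erase p, erase_subset _ _, hf.lower_subset
    (hf.isLowerFacet_erase l0 l1 lω hp hlp).mem_lowerFaces, _, ?_, hm⟩
  rw [lω]; linarith

/-- Above every point of the tetrahedron there is a point of the upper surface. -/
theorem IsUpFlip.exists_upper (hf : IsUpFlip ω T₁ T₂ t) {x : Plane} {z : ℝ}
    (h : (x, z) ∈ convexHull ℝ (liftSimplex ω t : Set (Plane × ℝ))) :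
    ∃ f ⊆ t, f ∈ T₂.faces ∧ ∃ z₁ ≥ z,
      (x, z₁) ∈ convexHull ℝ (liftSimplex ω f : Set (Plane × ℝ)) := by
  obtain ⟨l, l0, l1, lω, hl⟩ := hf.exists_circuit
  -- Descending along `-l` means going up.
  have ht : ∃ i ∈ t, -l i ≠ 0 := by
    obtain ⟨p, hp⟩ := card_pos.1 (hf.card_eq ▸ four_pos : 0 < t.card)
    exact ⟨p, hp, neg_ne_zero.2 (hl p hp)⟩
  have l0' : ∑ p ∈ t, -l p = 0 := by rw [Finset.sum_neg_distrib, l0, neg_zero]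
  obtain ⟨p, hp, hlp, c, hc, hm⟩ := exists_erase_mem l0'
    (by simp only [neg_smul, Finset.sum_neg_distrib, l1, neg_zero])
    (Finset.exists_pos_of_sum_zero_of_exists_nonzero _ l0' ht) h
  refine ⟨t.erase p, erase_subset _ _, hf.upper_subset
    (hf.isUpperFacet_erase l0 l1 lω hp (neg_pos.1 hlp)).mem_upperFaces, _, ?_, hm⟩
  simp only [neg_mul, Finset.sum_neg_distrib, lω]; linarith

/-- Every proper face of the tetrahedron belongs to its lower or to its upper surface. -/
theorem IsUpFlip.mem_faces_of_ssubset (hf : IsUpFlip ω T₁ T₂ t) {s : Finset Plane}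
    (hs : s ⊂ t) (hne : s.Nonempty) : s ∈ T₁.faces ∨ s ∈ T₂.faces := by
  obtain ⟨l, l0, l1, lω, hl⟩ := hf.exists_circuit
  obtain ⟨p, hp, hps⟩ := Finset.ssubset_iff_exists_subset_erase.1 hs
  rcases (hl p hp).lt_or_gt with h | h
  · exact Or.inr (hf.upper_subset ⟨hne, _, hf.isUpperFacet_erase l0 l1 lω hp h, hps⟩)
  · exact Or.inl (hf.lower_subset ⟨hne, _, hf.isLowerFacet_erase l0 l1 lω hp h, hps⟩)

/-! ### The effect of a flip -/

theorem IsUpFlip.height_le_of_mem (hf : IsUpFlip ω T₁ T₂ t) {x : Plane} {z : ℝ}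
    (h : (x, z) ∈ convexHull ℝ (liftSimplex ω t : Set (Plane × ℝ))) : height ω T₁ x ≤ z := by
  obtain ⟨f, -, hfT, z₀, hz, hm⟩ := hf.exists_lower h
  rwa [height_eq_of_mem hfT hm]

theorem IsUpFlip.le_height_of_mem (hf : IsUpFlip ω T₁ T₂ t) {x : Plane} {z : ℝ}
    (h : (x, z) ∈ convexHull ℝ (liftSimplex ω t : Set (Plane × ℝ))) : z ≤ height ω T₂ x := by
  obtain ⟨f, -, hfT, z₀, hz, hm⟩ := hf.exists_upper h
  rwa [height_eq_of_mem hfT hm]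

theorem subset_of_mem_lowerFaces {s : Finset Plane} (h : s ∈ lowerFaces ω t) : s ⊆ t := by
  obtain ⟨-, f, hf, hs⟩ := h
  exact hs.trans hf.1

theorem subset_of_mem_upperFaces {s : Finset Plane} (h : s ∈ upperFaces ω t) : s ⊆ t := by
  obtain ⟨-, f, hf, hs⟩ := h
  exact hs.trans hf.1

theorem IsUpFlip.mem_or_subset_left (hf : IsUpFlip ω T₁ T₂ t) {s : Finset Plane}
    (hs : s ∈ T₁.faces) : s ∈ T₂.faces ∨ s ⊆ t := by
  by_cases h : s ∈ lowerFaces ω t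
  · exact Or.inr (subset_of_mem_lowerFaces h)
  · exact Or.inl (hf.rest_eq.subset ⟨hs, h⟩).1

theorem IsUpFlip.mem_or_subset_right (hf : IsUpFlip ω T₁ T₂ t) {s : Finset Plane}
    (hs : s ∈ T₂.faces) : s ∈ T₁.faces ∨ s ⊆ t := by
  by_cases h : s ∈ upperFaces ω t
  · exact Or.inr (subset_of_mem_upperFaces h)
  · exact Or.inl (hf.rest_eq.symm.subset ⟨hs, h⟩).1

/-- A face carrying a point that does not move in the flip persists. -/
theorem IsUpFlip.mem_right_of_height_eq (hf : IsUpFlip ω T₁ T₂ t) {s : Finset Plane} {x : Plane}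
    {z : ℝ} (h : InRelInterior ω s x z) (hs : s ∈ T₁.faces) (hz : height ω T₂ x = z) :
    s ∈ T₂.faces := by
  refine (hf.mem_or_subset_left hs).elim id fun hst => ?_
  -- The upper face above the point has height `z` there, so it contains the point itself and
  -- therefore its carrier `s`.
  obtain ⟨f, hft, hfT, z₁, -, hm⟩ := hf.exists_upper (convexHull_liftSimplex_mono hst h.mem)
  obtain rfl : z = z₁ := hz ▸ height_eq_of_mem hfT hm
  exact T₂.down_closed hfT (h.subset_of_subset hf.nondegenerate hst hft hm)
    (T₁.nonempty_of_mem_faces hs)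

theorem IsUpFlip.mem_left_of_height_eq (hf : IsUpFlip ω T₁ T₂ t) {s : Finset Plane} {x : Plane}
    {z : ℝ} (h : InRelInterior ω s x z) (hs : s ∈ T₂.faces) (hz : height ω T₁ x = z) :
    s ∈ T₁.faces := by
  refine (hf.mem_or_subset_right hs).elim id fun hst => ?_
  obtain ⟨f, hft, hfT, z₁, -, hm⟩ := hf.exists_lower (convexHull_liftSimplex_mono hst h.mem)
  obtain rfl : z = z₁ := hz ▸ height_eq_of_mem hfT hm
  exact T₁.down_closed hfT (h.subset_of_subset hf.nondegenerate hst hft hm)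
    (T₂.nonempty_of_mem_faces hs)

theorem IsUpFlip.subset_left_of_height_ne (hf : IsUpFlip ω T₁ T₂ t) {s : Finset Plane} {x : Plane}
    {z : ℝ} (h : InRelInterior ω s x z) (hs : s ∈ T₁.faces) (hz : height ω T₂ x ≠ z) : s ⊆ t :=
  (hf.mem_or_subset_left hs).resolve_left fun h₂ => hz (height_eq_of_mem h₂ h.mem)

theorem IsUpFlip.subset_right_of_height_ne (hf : IsUpFlip ω T₁ T₂ t) {s : Finset Plane}
    {x : Plane} {z : ℝ} (h : InRelInterior ω s x z) (hs : s ∈ T₂.faces)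
    (hz : height ω T₁ x ≠ z) : s ⊆ t :=
  (hf.mem_or_subset_right hs).resolve_left fun h₂ => hz (height_eq_of_mem h₂ h.mem)

/-- The carrier of a point that moves cannot belong to both complexes, so its vertices lie in `t`.
-/
theorem IsUpFlip.mem_of_height_ne (hf : IsUpFlip ω T₁ T₂ t) (hsp : T₁.space = T₂.space)
    {x : Plane} (hx : x ∈ T₁.space) (hne : height ω T₁ x ≠ height ω T₂ x) :
    (x, height ω T₁ x) ∈ convexHull ℝ (liftSimplex ω t : Set (Plane × ℝ)) ∧
      (x, height ω T₂ x) ∈ convexHull ℝ (liftSimplex ω t : Set (Plane × ℝ)) := by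
  obtain ⟨s, hs, hc⟩ := exists_carrier_mem_faces (mem_sectionGraph_iff.2 ⟨hx, rfl⟩)
  obtain ⟨r, hr, hd⟩ := exists_carrier_mem_faces (mem_sectionGraph_iff.2 ⟨hsp ▸ hx, rfl⟩)
  exact ⟨convexHull_liftSimplex_mono (hf.subset_left_of_height_ne hc hs hne.symm) hc.mem,
    convexHull_liftSimplex_mono (hf.subset_right_of_height_ne hd hr hne) hd.mem⟩

theorem IsUpFlip.height_le (hf : IsUpFlip ω T₁ T₂ t) (hsp : T₁.space = T₂.space)
    {x : Plane} (hx : x ∈ T₁.space) : height ω T₁ x ≤ height ω T₂ x := by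
  by_contra hlt
  exact hlt (hf.le_height_of_mem (hf.mem_of_height_ne hsp hx (not_le.1 hlt).ne').1)

theorem IsUpFlip.affineSpan_eq_top (hf : IsUpFlip ω T₁ T₂ t) :
    affineSpan ℝ (liftSimplex ω t : Set (Plane × ℝ)) = ⊤ := by
  have := hf.nondegenerate.affineSpan_eq_top_iff_card_eq_finrank_add_one.2
    (by rw [Fintype.card_coe, liftSimplex, card_map, hf.card_eq]; simp)
  simpa using this

/-- Of two points of the tetrahedron on a vertical line, the midpoint is interior. -/
theorem IsUpFlip.midpoint_mem_interior (hf : IsUpFlip ω T₁ T₂ t) {x : Plane} {z₁ z₂ : ℝ}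
    (hne : z₁ ≠ z₂) (h₁ : (x, z₁) ∈ convexHull ℝ (liftSimplex ω t : Set (Plane × ℝ)))
    (h₂ : (x, z₂) ∈ convexHull ℝ (liftSimplex ω t : Set (Plane × ℝ))) :
    (x, (z₁ + z₂) / 2) ∈ interior (convexHull ℝ (liftSimplex ω t : Set (Plane × ℝ))) := by
  obtain ⟨w, w0, w1, w2, w3⟩ := mem_convexHull_liftSimplex.1 h₁
  obtain ⟨v, v0, v1, v2, v3⟩ := mem_convexHull_liftSimplex.1 h₂
  -- If both weights vanished at `p`, both points would lie over the triangle `t.erase p`, where the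
  -- projection determines the weights and hence the height.
  have hpos : ∀ p ∈ t, 0 < (w p + v p) / 2 := by
    intro p hp
    have hw := w0 p hp
    have hv := v0 p hp
    by_contra hle
    have hwp : w p = 0 := by linarith
    have hvp : v p = 0 := by linarith
    have hi := weights_unique (hf.general_position (t.erase p) (erase_subset _ _)
      (by rw [card_erase_of_mem hp, hf.card_eq])) (w := w) (v := v)
      (by rw [Finset.sum_erase _ hwp, Finset.sum_erase _ hvp, w1, v1])
      (by rw [Finset.sum_erase _ (by rw [hwp, zero_smul]),
        Finset.sum_erase _ (by rw [hvp, zero_smul]), w2, v2])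
    refine hne (w3.symm.trans (Eq.trans (Finset.sum_congr rfl fun q hq => ?_) v3))
    rcases eq_or_ne q p with rfl | hqp
    · rw [hwp, hvp]
    · rw [hi q (mem_erase.2 ⟨hqp, hq⟩)]
  refine InRelInterior.mem_interior hf.nondegenerate hf.affineSpan_eq_top
    ⟨fun p => (w p + v p) / 2, hpos, ?_, ?_, ?_⟩
  · rw [← Finset.sum_div, Finset.sum_add_distrib, w1, v1]
    norm_num
  · simp only [div_eq_inv_mul, mul_smul, ← Finset.smul_sum, add_smul, Finset.sum_add_distrib,
      w2, v2, ← two_smul ℝ x]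
    exact inv_smul_smul₀ two_ne_zero x
  · simp only [div_mul_eq_mul_div, add_mul, ← Finset.sum_div, Finset.sum_add_distrib, w3, v3]

/-- The projection is an open map, so the interior of the tetrahedron covers a neighbourhood of `x`
within the underlying space. -/
theorem IsUpFlip.mem_interior_of_height_ne (hf : IsUpFlip ω T₁ T₂ t) (hsp : T₁.space = T₂.space)
    {x : Plane} (hx : x ∈ T₁.space) (hne : height ω T₁ x ≠ height ω T₂ x) :
    x ∈ interior T₁.space := by
  have hm := hf.mem_of_height_ne hsp hx hne
  have hint := hf.midpoint_mem_interior hne hm.1 hm.2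
  refine interior_maximal ?_ (isOpenMap_fst _ isOpen_interior) ⟨_, hint, rfl⟩
  rintro _ ⟨⟨y, z⟩, hy, rfl⟩
  obtain ⟨f, -, hfT, z₀, -, hm⟩ := hf.exists_lower (interior_subset hy)
  exact SimplicialComplex.mem_space_iff.2 ⟨f, hfT, exists_mem_convexHull_liftSimplex.2 ⟨_, hm⟩⟩

end Facets

/-! ### Compactness -/

theorem IsPlaneTriangulation.subset_of_mem_faces {A : Finset Plane} {T : SimplicialComplex ℝ Plane}
    (hT : IsPlaneTriangulation A T) {s : Finset Plane} (hs : s ∈ T.faces) : s ⊆ A := by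
  intro p hp
  have : p ∈ T.vertices := T.down_closed hs (singleton_subset_iff.2 hp) (singleton_nonempty p)
  exact_mod_cast hT.vertices_subset this

theorem IsPlaneTriangulation.finite_faces {A : Finset Plane} {T : SimplicialComplex ℝ Plane}
    (hT : IsPlaneTriangulation A T) : T.faces.Finite :=
  A.powerset.finite_toSet.subset fun _ hs => by
    simpa using hT.subset_of_mem_faces hs

theorem isCompact_convexHull_finset {E : Type*} [NormedAddCommGroup E] [NormedSpace ℝ E]
    (s : Finset E) : IsCompact (convexHull ℝ (s : Set E)) :=
  s.finite_toSet.isCompact_convexHull (𝕜 := ℝ)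

theorem IsPlaneTriangulation.isCompact_sectionGraph {A : Finset Plane}
    {T : SimplicialComplex ℝ Plane} (hT : IsPlaneTriangulation A T) :
    IsCompact (sectionGraph ω T) :=
  (hT.finite_faces.image _).isCompact_biUnion fun s _ => isCompact_convexHull_finset s

/-- The set is the Minkowski sum of the compact section and the closed vertical set `{0} × R`; this
replaces continuity of `height`. -/
theorem IsPlaneTriangulation.isClosed_sub_height_mem {A : Finset Plane}
    {T : SimplicialComplex ℝ Plane} (hT : IsPlaneTriangulation A T) {R : Set ℝ} (hR : IsClosed R) :
    IsClosed {q : Plane × ℝ | q.1 ∈ T.space ∧ q.2 - height ω T q.1 ∈ R} := by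
  have h := (isClosed_singleton (x := (0 : Plane))).prod hR |>.add_left_of_isCompact
    (hT.isCompact_sectionGraph (ω := ω))
  convert h using 1
  ext ⟨x, z⟩
  rw [Set.mem_add]
  constructor
  · rintro ⟨hx, hz⟩
    exact ⟨(x, height ω T x), mem_sectionGraph_iff.2 ⟨hx, rfl⟩, (0, z - height ω T x), ⟨rfl, hz⟩,
      by simp⟩
  · rintro ⟨⟨y, a⟩, ha, ⟨y', b⟩, ⟨hy, hb⟩, hab⟩
    obtain ⟨hx, rfl⟩ := mem_sectionGraph_iff.1 ha
    obtain rfl : y' = 0 := hy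
    obtain ⟨rfl, rfl⟩ : y = x ∧ height ω T y + b = z := by simpa using hab
    exact ⟨hx, by simpa using hb⟩

/-! ### Sequences of up-flips -/

/-- A sequence of triangulations of `A` linked by up-flips with supports `t i`. -/
structure IsUpFlipSequence (A : Finset Plane) (ω : Plane → ℝ) (m : ℕ)
    (T : ℕ → SimplicialComplex ℝ Plane) (t : ℕ → Finset Plane) : Prop where
  triangulation : ∀ i ≤ m, IsPlaneTriangulation A (T i)
  flip : ∀ i < m, IsUpFlip ω (T i) (T (i + 1)) (t i)

namespace IsUpFlipSequence

variable {A : Finset Plane} {m : ℕ} {T : ℕ → SimplicialComplex ℝ Plane} {t : ℕ → Finset Plane}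
  {i j : ℕ} {x : Plane} {z : ℝ} {s r : Finset Plane}

theorem space_eq (h : IsUpFlipSequence A ω m T t) (hi : i ≤ m) :
    (T i).space = convexHull ℝ (A : Set Plane) :=
  (h.triangulation i hi).space_eq

theorem space_eq_succ (h : IsUpFlipSequence A ω m T t) (hi : i < m) :
    (T i).space = (T (i + 1)).space :=
  (h.space_eq hi.le).trans (h.space_eq hi).symm

theorem height_mono (h : IsUpFlipSequence A ω m T t) (hij : i ≤ j) (hj : j ≤ m)
    (hx : x ∈ convexHull ℝ (A : Set Plane)) : height ω (T i) x ≤ height ω (T j) x := by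
  induction j, hij using Nat.le_induction with
  | base => exact le_rfl
  | succ k _ ih =>
    exact (ih (by omega)).trans ((h.flip k hj).height_le (h.space_eq_succ hj)
      (by rwa [h.space_eq (by omega)]))

/-- By monotonicity the height at `x` is constant between `i` and `j`, and a flip that does not move
a point preserves its carrier. -/
theorem mem_faces_iff_of_height_eq (h : IsUpFlipSequence A ω m T t) (hij : i ≤ j) (hj : j ≤ m)
    (hx : x ∈ convexHull ℝ (A : Set Plane)) (hs : InRelInterior ω s x z)
    (hzi : height ω (T i) x = z) (hzj : height ω (T j) x = z) :
    s ∈ (T i).faces ↔ s ∈ (T j).faces := by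
  induction j, hij using Nat.le_induction with
  | base => rfl
  | succ k hk ih =>
    have hzk : height ω (T k) x = z :=
      le_antisymm (hzj ▸ h.height_mono k.le_succ hj hx)
        (hzi ▸ h.height_mono hk (by omega) hx)
    rw [ih (by omega) hzk]
    exact ⟨fun hm => (h.flip k hj).mem_right_of_height_eq hs hm hzj,
      fun hm => (h.flip k hj).mem_left_of_height_eq hs hm hzk⟩

theorem mem_faces_or_subset (h : IsUpFlipSequence A ω m T t) (hij : i ≤ j) (hj : j ≤ m)
    (hs : s ∈ (T i).faces) : s ∈ (T j).faces ∨ ∃ k < m, s ⊆ t k := by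
  induction j, hij using Nat.le_induction with
  | base => exact Or.inl hs
  | succ k _ ih =>
    rcases ih (by omega) with hk | hk
    · exact ((h.flip k hj).mem_or_subset_left hk).imp_right fun hk => ⟨k, hj, hk⟩
    · exact Or.inr hk

theorem mem_faces_or_subset' (h : IsUpFlipSequence A ω m T t) (hij : i ≤ j) (hj : j ≤ m)
    (hs : s ∈ (T j).faces) : s ∈ (T i).faces ∨ ∃ k < m, s ⊆ t k := by
  induction j, hij using Nat.le_induction with
  | base => exact Or.inl hs
  | succ k _ ih =>
    rcases (h.flip k hj).mem_or_subset_right hs with hk | hk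
    · exact ih (by omega) hk
    · exact Or.inr ⟨k, hj, hk⟩

/-- Between two sections, a point above the first one lies in some tetrahedron. -/
theorem exists_between (h : IsUpFlipSequence A ω m T t) (hij : i ≤ j) (hj : j ≤ m)
    (hx : x ∈ convexHull ℝ (A : Set Plane)) (hiz : height ω (T i) x < z)
    (hzj : z ≤ height ω (T j) x) :
    ∃ k < m, height ω (T k) x ≠ height ω (T (k + 1)) x ∧
      (x, z) ∈ convexHull ℝ (liftSimplex ω (t k) : Set (Plane × ℝ)) := by
  induction j, hij using Nat.le_induction with
  | base => exact absurd hzj (not_le.2 hiz)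
  | succ k _ ih =>
    rcases le_or_gt z (height ω (T k) x) with hz | hz
    · exact ih (by omega) hz
    · have hne := (hz.trans_le hzj).ne
      refine ⟨k, hj, hne, ?_⟩
      -- The endpoints of the vertical segment between the sections `k` and `k + 1` lie in the
      -- tetrahedron, which is convex.
      have hm := (h.flip k hj).mem_of_height_ne (h.space_eq_succ hj)
        (by rwa [h.space_eq (by omega)]) hne
      refine (convex_convexHull ℝ _).segment_subset hm.1 hm.2 ?_
      have := segment_eq_Icc (𝕜 := ℝ) (hz.le.trans hzj)
      rw [← Prod.image_mk_segment_right, this]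
      exact ⟨z, ⟨hz.le, hzj⟩, rfl⟩

theorem mem_convexHull_of_mem_support (h : IsUpFlipSequence A ω m T t) (hi : i < m)
    (hx : (x, z) ∈ convexHull ℝ (liftSimplex ω (t i) : Set (Plane × ℝ))) :
    x ∈ convexHull ℝ (A : Set Plane) := by
  obtain ⟨f, -, hf, _, -, hm⟩ := (h.flip i hi).exists_lower hx
  rw [← h.space_eq hi.le]
  exact SimplicialComplex.mem_space_iff.2 ⟨f, hf, exists_mem_convexHull_liftSimplex.2 ⟨_, hm⟩⟩

theorem mem_region_of_mem_support (h : IsUpFlipSequence A ω m T t) (hi : i < m)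
    (hx : (x, z) ∈ convexHull ℝ (liftSimplex ω (t i) : Set (Plane × ℝ))) :
    (x, z) ∈ regionBetween ω (T 0) (T m) := by
  have hA := h.mem_convexHull_of_mem_support hi hx
  rw [mem_regionBetween_iff ((h.space_eq (Nat.zero_le _)).trans (h.space_eq le_rfl).symm),
    h.space_eq (Nat.zero_le _)]
  exact ⟨hA, (h.height_mono (Nat.zero_le _) hi.le hA).trans ((h.flip i hi).height_le_of_mem hx),
    ((h.flip i hi).le_height_of_mem hx).trans (h.height_mono hi le_rfl hA)⟩

theorem mem_region_of_mem_faces (h : IsUpFlipSequence A ω m T t) (hi : i ≤ m)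
    (hs : s ∈ (T i).faces)
    (hx : (x, z) ∈ convexHull ℝ (liftSimplex ω s : Set (Plane × ℝ))) :
    (x, z) ∈ regionBetween ω (T 0) (T m) := by
  obtain ⟨hA, rfl⟩ := mem_sectionGraph_iff.1 (mem_sectionGraph.2 ⟨s, hs, hx⟩)
  rw [h.space_eq hi] at hA
  rw [mem_regionBetween_iff ((h.space_eq (Nat.zero_le _)).trans (h.space_eq le_rfl).symm),
    h.space_eq (Nat.zero_le _)]
  exact ⟨hA, h.height_mono (Nat.zero_le _) hi hA, h.height_mono hi le_rfl hA⟩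

theorem mem_region_iff (h : IsUpFlipSequence A ω m T t) :
    (x, z) ∈ regionBetween ω (T 0) (T m) ↔ x ∈ convexHull ℝ (A : Set Plane) ∧
      height ω (T 0) x ≤ z ∧ z ≤ height ω (T m) x := by
  rw [mem_regionBetween_iff ((h.space_eq (Nat.zero_le _)).trans (h.space_eq le_rfl).symm),
    h.space_eq (Nat.zero_le _)]

/-! ### The tetrahedra are stacked -/

/-- The carrier of the common point is a face of `s`; as the heights agree it also belongs to `T j`,
where it must be a face of `r`. -/
theorem mem_convexHull_inter_of_mem_faces (h : IsUpFlipSequence A ω m T t) (hi : i ≤ m)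
    (hj : j ≤ m) (hs : s ∈ (T i).faces) (hr : r ∈ (T j).faces)
    (hxs : (x, z) ∈ convexHull ℝ (liftSimplex ω s : Set (Plane × ℝ)))
    (hxr : (x, z) ∈ convexHull ℝ (liftSimplex ω r : Set (Plane × ℝ))) :
    (x, z) ∈ convexHull ℝ (liftSimplex ω s ∩ liftSimplex ω r : Set (Plane × ℝ)) := by
  wlog hij : i ≤ j generalizing i j s r
  · rw [Set.inter_comm]
    exact this hj hi hr hs hxr hxs (le_of_not_ge hij)
  obtain ⟨c, hcs, hc, hcx⟩ := exists_carrier hxs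
  have hx : x ∈ convexHull ℝ (A : Set Plane) := by
    rw [← h.space_eq hi]
    exact SimplicialComplex.mem_space_iff.2 ⟨s, hs, exists_mem_convexHull_liftSimplex.2 ⟨z, hxs⟩⟩
  have hcj : c ∈ (T j).faces := (h.mem_faces_iff_of_height_eq hij hj hx hcx
    (height_eq_of_mem hs hxs) (height_eq_of_mem hr hxr)).1 ((T i).down_closed hs hcs hc)
  have hcr := hcx.subset_of_mem_faces hcj hr (exists_mem_convexHull_liftSimplex.2 ⟨z, hxr⟩)
  exact convexHull_mono (Set.subset_inter (by exact_mod_cast liftSimplex_mono hcs)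
    (by exact_mod_cast liftSimplex_mono hcr)) hcx.mem

theorem mem_convexHull_inter_of_mem_support_of_mem_faces (h : IsUpFlipSequence A ω m T t)
    (hi : i < m) (hj : j ≤ m) (hr : r ∈ (T j).faces)
    (hxs : (x, z) ∈ convexHull ℝ (liftSimplex ω (t i) : Set (Plane × ℝ)))
    (hxr : (x, z) ∈ convexHull ℝ (liftSimplex ω r : Set (Plane × ℝ))) :
    (x, z) ∈ convexHull ℝ (liftSimplex ω (t i) ∩ liftSimplex ω r : Set (Plane × ℝ)) := by
  have hx := h.mem_convexHull_of_mem_support hi hxs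
  have hz := height_eq_of_mem hr hxr
  suffices ∃ f ⊆ t i, ∃ k ≤ m, f ∈ (T k).faces ∧
      (x, z) ∈ convexHull ℝ (liftSimplex ω f : Set (Plane × ℝ)) by
    obtain ⟨f, hft, k, hk, hf, hxf⟩ := this
    exact convexHull_mono (Set.inter_subset_inter_left _ (by exact_mod_cast liftSimplex_mono hft))
      (h.mem_convexHull_inter_of_mem_faces hk hj hf hr hxf hxr)
  -- The tetrahedron lies between the sections `i` and `i + 1`. A common point with section `j` is
  -- thus on the lower surface if `j ≤ i` and on the upper one if `i + 1 ≤ j`.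
  rcases le_or_gt j i with hji | hij
  · obtain ⟨f, hft, hf, a, haz, hm⟩ := (h.flip i hi).exists_lower hxs
    have h1 := h.height_mono hji hi.le hx
    have h2 := height_eq_of_mem hf hm
    obtain rfl : a = z := by linarith
    exact ⟨f, hft, i, hi.le, hf, hm⟩
  · obtain ⟨f, hft, hf, a, haz, hm⟩ := (h.flip i hi).exists_upper hxs
    have h1 := h.height_mono hij hj hx
    have h2 := height_eq_of_mem hf hm
    obtain rfl : a = z := by linarith
    exact ⟨f, hft, i + 1, hi, hf, hm⟩

/-- For `i < j` the first tetrahedron is below section `j` and the second above it, so common points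
lie on the lower surface of the second. -/
theorem mem_convexHull_inter_of_mem_support (h : IsUpFlipSequence A ω m T t) (hi : i < m)
    (hj : j < m) (hxi : (x, z) ∈ convexHull ℝ (liftSimplex ω (t i) : Set (Plane × ℝ)))
    (hxj : (x, z) ∈ convexHull ℝ (liftSimplex ω (t j) : Set (Plane × ℝ))) :
    (x, z) ∈ convexHull ℝ (liftSimplex ω (t i) ∩ liftSimplex ω (t j) : Set (Plane × ℝ)) := by
  wlog hij : i ≤ j generalizing i j
  · rw [Set.inter_comm]
    exact this hj hi hxj hxi (le_of_not_ge hij)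
  rcases hij.eq_or_lt with rfl | hij
  · rwa [Set.inter_self]
  have hx := h.mem_convexHull_of_mem_support hi hxi
  obtain ⟨f, hft, hf, a, haz, hm⟩ := (h.flip j hj).exists_lower hxj
  have h1 := height_eq_of_mem hf hm
  have h2 := h.height_mono hij hj.le hx
  have h3 := (h.flip i hi).le_height_of_mem hxi
  obtain rfl : a = z := by linarith
  exact convexHull_mono (Set.inter_subset_inter_right _ (by exact_mod_cast liftSimplex_mono hft))
    (h.mem_convexHull_inter_of_mem_support_of_mem_faces hi hj.le hf hxi hm)

/-- A tetrahedron used at steps `i < j` would lie both below and above section `j`, hence inside a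
graph, yet it has interior points. -/
theorem injOn_support (h : IsUpFlipSequence A ω m T t) : Set.InjOn t (Set.Iio m) := by
  intro i hi j hj hij
  wlog hlt : i < j generalizing i j
  · rcases (not_lt.1 hlt).eq_or_lt with he | hlt
    · exact he.symm
    · exact (this hj hi hij.symm hlt).symm
  exfalso
  rw [Set.mem_Iio] at hi hj
  have hne : (interior (convexHull ℝ (liftSimplex ω (t i) : Set (Plane × ℝ)))).Nonempty :=
    interior_convexHull_nonempty_iff_affineSpan_eq_top.2 (h.flip i hi).affineSpan_eq_top
  obtain ⟨⟨x, z⟩, hq⟩ := hne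
  have hmem : ∀ᶠ a in nhds z,
      (x, a) ∈ convexHull ℝ (liftSimplex ω (t i) : Set (Plane × ℝ)) :=
    (Continuous.prodMk_right x).continuousAt.eventually (mem_interior_iff_mem_nhds.1 hq)
  have hval : ∀ a, (x, a) ∈ convexHull ℝ (liftSimplex ω (t i) : Set (Plane × ℝ)) →
      a = height ω (T j) x := by
    intro a ha
    have hx := h.mem_convexHull_of_mem_support hi ha
    exact le_antisymm
      (((h.flip i hi).le_height_of_mem ha).trans (h.height_mono hlt hj.le hx))
      ((h.flip j hj).height_le_of_mem (hij ▸ ha))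
  obtain ⟨a, ha, hza⟩ := (hmem.filter_mono nhdsWithin_le_nhds |>.and
    (self_mem_nhdsWithin : Set.Ioi z ∈ nhdsWithin z (Set.Ioi z))).exists
  exact hza.ne ((hval z (interior_subset hq)).trans (hval a ha).symm)

/-! ### The triangulation of the region -/

theorem mem_sweptFaces {q : Finset (Plane × ℝ)} : q ∈ sweptFaces ω m T t ↔
    ∃ s, liftSimplex ω s = q ∧ ((∃ i ≤ m, s ∈ (T i).faces) ∨ ∃ i < m, s = t i) := by
  simp only [sweptFaces, liftedFaces, Set.mem_ofPred_eq, Set.mem_image]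
  grind

/-- The complex of all swept simplices. -/
def sweptComplex (h : IsUpFlipSequence A ω m T t) : SimplicialComplex ℝ (Plane × ℝ) where
  faces := sweptFaces ω m T t
  isRelLowerSet_faces := by
    intro q hq
    obtain ⟨s, rfl, hs⟩ := mem_sweptFaces.1 hq
    refine ⟨?_, fun q' hq' hne => ?_⟩
    · refine Finset.Nonempty.map ?_
      rcases hs with ⟨i, -, hs⟩ | ⟨i, hi, rfl⟩
      · exact (T i).nonempty_of_mem_faces hs
      · exact card_pos.1 ((h.flip i hi).card_eq ▸ four_pos)
    · obtain ⟨r, hrs, rfl⟩ := Finset.subset_map_iff.1 hq'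
      have hr : r.Nonempty := Finset.map_nonempty.1 hne
      refine mem_sweptFaces.2 ⟨r, rfl, ?_⟩
      rcases hs with ⟨i, hi, hs⟩ | ⟨i, hi, rfl⟩
      · exact Or.inl ⟨i, hi, (T i).down_closed hs hrs hr⟩
      · rcases eq_or_ne r (t i) with rfl | hne
        · exact Or.inr ⟨i, hi, rfl⟩
        · rcases (h.flip i hi).mem_faces_of_ssubset (hrs.ssubset_of_ne hne) hr with hr | hr
          · exact Or.inl ⟨i, hi.le, hr⟩
          · exact Or.inl ⟨i + 1, hi, hr⟩
  indep := by
    intro q hq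
    obtain ⟨s, rfl, ⟨i, -, hs⟩ | ⟨i, hi, rfl⟩⟩ := mem_sweptFaces.1 hq
    · exact affineIndependent_liftSimplex ((T i).indep hs)
    · exact (h.flip i hi).nondegenerate
  inter_subset_convexHull := by
    rintro q q' hq hq' ⟨x, z⟩ ⟨hx, hx'⟩
    obtain ⟨s, rfl, ⟨i, hi, hs⟩ | ⟨i, hi, rfl⟩⟩ := mem_sweptFaces.1 hq <;>
    obtain ⟨r, rfl, ⟨j, hj, hr⟩ | ⟨j, hj, rfl⟩⟩ := mem_sweptFaces.1 hq'
    · exact h.mem_convexHull_inter_of_mem_faces hi hj hs hr hx hx'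
    · rw [Set.inter_comm]
      exact h.mem_convexHull_inter_of_mem_support_of_mem_faces hj hi hs hx' hx
    · exact h.mem_convexHull_inter_of_mem_support_of_mem_faces hi hj hr hx hx'
    · exact h.mem_convexHull_inter_of_mem_support hi hj hx hx'

/-- The bottom section is listed separately because the solid may be flat, outside all tetrahedra,
where no flip moves the section. -/
theorem mem_region_iff_exists (h : IsUpFlipSequence A ω m T t) :
    (x, z) ∈ regionBetween ω (T 0) (T m) ↔ (x, z) ∈ sectionGraph ω (T 0) ∨
      ∃ i < m, (x, z) ∈ convexHull ℝ (liftSimplex ω (t i) : Set (Plane × ℝ)) := by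
  constructor
  · intro hr
    obtain ⟨hx, h0, h1⟩ := h.mem_region_iff.1 hr
    rcases h0.eq_or_lt with h0 | h0
    · exact Or.inl (mem_sectionGraph_iff.2 ⟨by rwa [h.space_eq (Nat.zero_le _)], h0.symm⟩)
    · obtain ⟨k, hk, -, hm⟩ := h.exists_between (Nat.zero_le m) le_rfl hx h0 h1
      exact Or.inr ⟨k, hk, hm⟩
  · rintro (h0 | ⟨i, hi, hm⟩)
    · obtain ⟨s, hs, hm⟩ := mem_sectionGraph.1 h0
      exact h.mem_region_of_mem_faces (Nat.zero_le _) hs hm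
    · exact h.mem_region_of_mem_support hi hm

theorem isTriangulation_sweptComplex (h : IsUpFlipSequence A ω m T t) :
    IsTriangulation h.sweptComplex (lift ω '' (A : Set Plane))
      (regionBetween ω (T 0) (T m)) where
  vertices_subset := by
    intro v hv
    have hv : {v} ∈ sweptFaces ω m T t := hv
    obtain ⟨s, hsv, ⟨i, hi, hs⟩ | ⟨i, hi, rfl⟩⟩ := mem_sweptFaces.1 hv
    · have : v ∈ liftSimplex ω s := hsv ▸ mem_singleton_self v
      obtain ⟨p, hp, rfl⟩ := Finset.mem_map.1 this
      exact ⟨p, (h.triangulation i hi).subset_of_mem_faces hs hp, rfl⟩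
    · have := congrArg card hsv
      rw [liftSimplex, card_map, (h.flip i hi).card_eq, card_singleton] at this
      norm_num at this
  space_eq := by
    ext ⟨x, z⟩
    rw [SimplicialComplex.mem_space_iff]
    constructor
    · rintro ⟨q, hq, hm⟩
      obtain ⟨s, rfl, ⟨i, hi, hs⟩ | ⟨i, hi, rfl⟩⟩ := mem_sweptFaces.1 hq
      · exact h.mem_region_of_mem_faces hi hs hm
      · exact h.mem_region_of_mem_support hi hm
    · intro hr
      rcases h.mem_region_iff_exists.1 hr with h0 | ⟨i, hi, hm⟩
      · obtain ⟨s, hs, hm⟩ := mem_sectionGraph.1 h0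
        exact ⟨_, mem_sweptFaces.2 ⟨s, rfl, Or.inl ⟨0, Nat.zero_le _, hs⟩⟩, hm⟩
      · exact ⟨_, mem_sweptFaces.2 ⟨_, rfl, Or.inr ⟨i, hi, rfl⟩⟩, hm⟩

/-! ### Boundary and interior of the region -/

theorem isClosed_iUnion_support (ω : Plane → ℝ) (m : ℕ) (t : ℕ → Finset Plane) :
    IsClosed (⋃ i ∈ Set.Iio m, convexHull ℝ (liftSimplex ω (t i) : Set (Plane × ℝ))) :=
  (Set.finite_Iio m).isClosed_biUnion fun _ _ => (isCompact_convexHull_finset _).isClosed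

theorem region_eq (h : IsUpFlipSequence A ω m T t) :
    regionBetween ω (T 0) (T m) = sectionGraph ω (T 0) ∪
      ⋃ i ∈ Set.Iio m, convexHull ℝ (liftSimplex ω (t i) : Set (Plane × ℝ)) := by
  ext ⟨x, z⟩
  rw [h.mem_region_iff_exists]
  simp

theorem isClosed_region (h : IsUpFlipSequence A ω m T t) :
    IsClosed (regionBetween ω (T 0) (T m)) := by
  rw [h.region_eq]
  exact (h.triangulation 0 (Nat.zero_le _)).isCompact_sectionGraph.isClosed.union
    (isClosed_iUnion_support ω m t)

theorem mem_interior_of_height_lt (h : IsUpFlipSequence A ω m T t)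
    (hx : x ∈ convexHull ℝ (A : Set Plane)) (h0 : height ω (T 0) x < z)
    (hm : z ≤ height ω (T m) x) : x ∈ interior (convexHull ℝ (A : Set Plane)) := by
  obtain ⟨k, hk, hne, -⟩ := h.exists_between (Nat.zero_le m) le_rfl hx h0 hm
  rw [← h.space_eq hk.le] at hx ⊢
  exact (h.flip k hk).mem_interior_of_height_ne (h.space_eq_succ hk) hx hne

theorem mem_interior_region (h : IsUpFlipSequence A ω m T t)
    (hx : x ∈ convexHull ℝ (A : Set Plane)) (h0 : height ω (T 0) x < z)
    (hm : z < height ω (T m) x) : (x, z) ∈ interior (regionBetween ω (T 0) (T m)) := by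
  have hT0 := h.triangulation 0 (Nat.zero_le _)
  have hTm := h.triangulation m le_rfl
  have hs0 := h.space_eq (Nat.zero_le m)
  have hsm := h.space_eq le_rfl
  -- Points over the interior of `conv A` that are neither weakly below the bottom section nor
  -- weakly above the top one. Away from `conv A` the two complements impose nothing, so the first
  -- factor is needed.
  have hopen := ((isOpen_interior (s := convexHull ℝ (A : Set Plane))).preimage
    continuous_fst).inter ((hT0.isClosed_sub_height_mem (ω := ω) (isClosed_Iic (a := 0))
      |>.isOpen_compl).inter (hTm.isClosed_sub_height_mem (ω := ω) (isClosed_Ici (a := 0))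
      |>.isOpen_compl))
  refine interior_maximal ?_ hopen ⟨h.mem_interior_of_height_lt hx h0 hm.le, ?_, ?_⟩
  · rintro ⟨y, a⟩ ⟨hy, hy0, hym⟩
    have hyA := interior_subset hy
    simp only [Set.mem_compl_iff, Set.mem_ofPred_eq, hs0, hsm, Set.mem_Iic, Set.mem_Ici,
      not_and, not_le, sub_pos, sub_neg] at hy0 hym
    exact h.mem_region_iff.2 ⟨hyA, (hy0 hyA).le, (hym hyA).le⟩
  · simp only [Set.mem_compl_iff, Set.mem_ofPred_eq, Set.mem_Iic, not_and, not_le, sub_pos]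
    exact fun _ => h0
  · simp only [Set.mem_compl_iff, Set.mem_ofPred_eq, Set.mem_Ici, not_and, not_le, sub_neg]
    exact fun _ => hm

/-- An interior point of the region lies strictly between the two sections. -/
theorem height_lt_of_mem_interior (h : IsUpFlipSequence A ω m T t)
    (hq : (x, z) ∈ interior (regionBetween ω (T 0) (T m))) :
    height ω (T 0) x < z ∧ z < height ω (T m) x := by
  have hmem : ∀ᶠ a in nhds z, (x, a) ∈ regionBetween ω (T 0) (T m) :=
    (Continuous.prodMk_right x).continuousAt.eventually (mem_interior_iff_mem_nhds.1 hq)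
  obtain ⟨a, ha, hza⟩ := (hmem.filter_mono nhdsWithin_le_nhds |>.and
    (self_mem_nhdsWithin : Set.Ioi z ∈ nhdsWithin z (Set.Ioi z))).exists
  obtain ⟨b, hb, hzb⟩ := (hmem.filter_mono nhdsWithin_le_nhds |>.and
    (self_mem_nhdsWithin : Set.Iio z ∈ nhdsWithin z (Set.Iio z))).exists
  exact ⟨(h.mem_region_iff.1 hb).2.1.trans_lt hzb,
    (Set.mem_Ioi.1 hza).trans_le (h.mem_region_iff.1 ha).2.2⟩

theorem frontier_region (h : IsUpFlipSequence A ω m T t) :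
    frontier (regionBetween ω (T 0) (T m)) = sectionGraph ω (T 0) ∪ sectionGraph ω (T m) := by
  rw [h.isClosed_region.frontier_eq]
  ext ⟨x, z⟩
  rw [Set.mem_sdiff, Set.mem_union, mem_sectionGraph_iff, mem_sectionGraph_iff,
    h.space_eq (Nat.zero_le m), h.space_eq le_rfl, h.mem_region_iff]
  constructor
  · rintro ⟨⟨hx, h0, hm⟩, hint⟩
    by_contra! hne
    exact hint (h.mem_interior_region hx (h0.lt_of_ne' (hne.1 hx)) (hm.lt_of_ne (hne.2 hx)))
  · rintro (⟨hx, rfl⟩ | ⟨hx, rfl⟩)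
    · exact ⟨⟨hx, le_rfl, h.height_mono (Nat.zero_le m) le_rfl hx⟩,
        fun hint => (h.height_lt_of_mem_interior hint).1.false⟩
    · exact ⟨⟨hx, h.height_mono (Nat.zero_le m) le_rfl hx, le_rfl⟩,
        fun hint => (h.height_lt_of_mem_interior hint).2.false⟩

/-- Each tetrahedron is a convex body, the closure of its own interior. Conversely the union is
closed and contains every point strictly between the sections. -/
theorem iUnion_support_eq (h : IsUpFlipSequence A ω m T t) :
    (⋃ i ∈ Set.Iio m, convexHull ℝ (liftSimplex ω (t i) : Set (Plane × ℝ))) =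
      closure (interior (regionBetween ω (T 0) (T m))) := by
  apply Set.Subset.antisymm
  · refine Set.iUnion₂_subset fun i hi => ?_
    have hsub : convexHull ℝ (liftSimplex ω (t i) : Set (Plane × ℝ)) ⊆
        regionBetween ω (T 0) (T m) := fun q hq => h.mem_region_of_mem_support hi hq
    refine Set.Subset.trans ?_ (closure_mono (interior_mono hsub))
    rw [(convex_convexHull ℝ _).closure_interior_eq_closure_of_nonempty_interior
      (interior_convexHull_nonempty_iff_affineSpan_eq_top.2 (h.flip i hi).affineSpan_eq_top)]
    exact subset_closure
  · refine closure_minimal ?_ (isClosed_iUnion_support ω m t)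
    rintro ⟨x, z⟩ hq
    obtain ⟨hx, -, hm⟩ := h.mem_region_iff.1 (interior_subset hq)
    obtain ⟨k, hk, -, hmem⟩ := h.exists_between (Nat.zero_le m) le_rfl hx
      (h.height_lt_of_mem_interior hq).1 hm
    exact Set.mem_iUnion₂.2 ⟨k, hk, hmem⟩

/-! ### Sections that meet only above the boundary -/

/-- A face whose relative interior meets the interior of `conv A` cannot belong to both `T 0` and `T
m`, so some flip involves it. The faces contained in supports therefore cover the interior of `conv
A`, and being finitely many compact sets they cover its closure. A boundary face is then contained
in one of them. -/
theorem exists_support_superset (h : IsUpFlipSequence A ω m T t) (hm : 0 < m)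
    (hlt : ∀ x ∈ interior (convexHull ℝ (A : Set Plane)), height ω (T 0) x < height ω (T m) x)
    (hi : i ≤ m) (hs : s ∈ (T i).faces) : ∃ k < m, s ⊆ t k := by
  have key : ∀ r ∈ (T i).faces, ∀ x z, InRelInterior ω r x z →
      x ∈ interior (convexHull ℝ (A : Set Plane)) → ∃ k < m, r ⊆ t k := by
    intro r hr x z hrx hx
    rcases h.mem_faces_or_subset' (Nat.zero_le i) hi hr with h0 | h0
    · rcases h.mem_faces_or_subset hi le_rfl hr with h1 | h1
      · have := hlt x hx
        rw [height_eq_of_mem h0 hrx.mem, height_eq_of_mem h1 hrx.mem] at this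
        exact absurd this (lt_irrefl _)
      · exact h1
    · exact h0
  have hclosed : IsClosed (⋃ r ∈ {r ∈ (T i).faces | ∃ k < m, r ⊆ t k},
      convexHull ℝ (r : Set Plane)) :=
    ((h.triangulation i hi).finite_faces.subset (Set.sep_subset _ _)).isClosed_biUnion
      fun _ _ => (isCompact_convexHull_finset _).isClosed
  have hne : (interior (convexHull ℝ (A : Set Plane))).Nonempty := by
    obtain ⟨⟨x, z⟩, hq⟩ :=
      interior_convexHull_nonempty_iff_affineSpan_eq_top.2 (h.flip 0 hm).affineSpan_eq_top
    have hq' := interior_mono (fun q hq => h.mem_region_of_mem_support hm hq) hq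
    have := h.height_lt_of_mem_interior hq'
    exact ⟨x, h.mem_interior_of_height_lt (h.mem_region_iff.1 (interior_subset hq')).1 this.1
      this.2.le⟩
  have hcover : convexHull ℝ (A : Set Plane) ⊆ ⋃ r ∈ {r ∈ (T i).faces | ∃ k < m, r ⊆ t k},
      convexHull ℝ (r : Set Plane) := by
    refine subset_closure.trans ?_
    rw [← (convex_convexHull ℝ _).closure_interior_eq_closure_of_nonempty_interior hne]
    refine closure_minimal (fun x hx => ?_) hclosed
    obtain ⟨r, hr, hrx⟩ := exists_carrier_mem_faces (mem_sectionGraph_iff (ω := ω) (T := T i).2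
      ⟨by rw [h.space_eq hi]; exact interior_subset hx, rfl⟩)
    exact Set.mem_iUnion₂.2 ⟨r, ⟨hr, key r hr x _ hrx hx⟩,
      exists_mem_convexHull_liftSimplex.2 ⟨_, hrx.mem⟩⟩
  -- The barycentre serves as a relative interior point of `s`.
  obtain ⟨x, z, hsx⟩ : ∃ x z, InRelInterior ω s x z := by
    have hc : (0 : ℝ) < s.card := Nat.cast_pos.2 (card_pos.2 ((T i).nonempty_of_mem_faces hs))
    exact ⟨_, _, fun _ => (s.card : ℝ)⁻¹, fun _ _ => inv_pos.2 hc,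
      by rw [Finset.sum_const, nsmul_eq_mul, mul_inv_cancel₀ hc.ne'], rfl, rfl⟩
  have hx : x ∈ convexHull ℝ (A : Set Plane) := by
    rw [← h.space_eq hi]
    exact SimplicialComplex.mem_space_iff.2
      ⟨s, hs, exists_mem_convexHull_liftSimplex.2 ⟨z, hsx.mem⟩⟩
  obtain ⟨r, ⟨hr, k, hk, hrk⟩, hxr⟩ := Set.mem_iUnion₂.1 (hcover hx)
  exact ⟨k, hk, (hsx.subset_of_mem_faces hs hr hxr).trans hrk⟩

end IsUpFlipSequence

/-- A strictly lower first triangulation forces the flips of a monotone sequence to be up-flips. -/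
theorem IsMonotoneFlipSequence.isUpFlipSequence {A : Finset Plane} {m : ℕ}
    {T : ℕ → SimplicialComplex ℝ Plane} {t : ℕ → Finset Plane}
    (h : IsMonotoneFlipSequence A ω m T t) (hlt : LiesStrictlyLower ω (T 0) (T m)) :
    IsUpFlipSequence A ω m T t := by
  refine ⟨h.triangulation, h.monotone.resolve_right fun hdown => hlt.2 ?_⟩
  have hsp : ∀ i ≤ m, (T i).space = convexHull ℝ (A : Set Plane) := fun i hi =>
    (h.triangulation i hi).space_eq
  rw [liesLower_iff ((hsp m le_rfl).trans (hsp 0 (Nat.zero_le _)).symm), hsp m le_rfl]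
  intro x hx
  have : ∀ i ≤ m, height ω (T i) x ≤ height ω (T 0) x := by
    intro i hi
    induction i with
    | zero => exact le_rfl
    | succ k ih =>
      have hf : IsUpFlip ω (T (k + 1)) (T k) (t k) := hdown k hi
      exact (hf.height_le ((hsp _ hi).trans (hsp _ (by omega)).symm) (by rwa [hsp _ hi])).trans
        (ih (by omega))
  exact this m le_rfl

end DirectedFlips

/-! ### Assembly of the five claims -/

theorem mainTheorem5 (A : Finset DirectedFlips.Plane) (ω : DirectedFlips.Plane → ℝ)
    (Tu Tv : Geometry.SimplicialComplex ℝ DirectedFlips.Plane)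
    (hTu : DirectedFlips.IsPlaneTriangulation A Tu)
    (hTv : DirectedFlips.IsPlaneTriangulation A Tv)
    (hlt : DirectedFlips.LiesStrictlyLower ω Tu Tv)
    (m : ℕ) (T : ℕ → Geometry.SimplicialComplex ℝ DirectedFlips.Plane)
    (t : ℕ → Finset DirectedFlips.Plane)
    (hseq : DirectedFlips.IsMonotoneFlipSequence A ω m T t)
    (hstart : T 0 = Tu) (hend : T m = Tv) :
    -- the region between the two surfaces is a solid bounded by them
    frontier (DirectedFlips.regionBetween ω Tu Tv) =
        DirectedFlips.sectionGraph ω Tu ∪ DirectedFlips.sectionGraph ω Tv ∧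
    -- the flips are in bijection with the tetrahedra
    Set.InjOn t (Set.Iio m) ∧
    -- the swept simplices form a triangulation of the solid, with vertices among the lifted points
    (∃ K : Geometry.SimplicialComplex ℝ (DirectedFlips.Plane × ℝ),
      K.faces = DirectedFlips.sweptFaces ω m T t ∧
      DirectedFlips.IsTriangulation K (DirectedFlips.lift ω '' (A : Set DirectedFlips.Plane))
        (DirectedFlips.regionBetween ω Tu Tv)) ∧
    -- the tetrahedra fill the three-dimensional part of the solid
    (⋃ i ∈ Set.Iio m, convexHull ℝ
        (DirectedFlips.liftSimplex ω (t i) : Set (DirectedFlips.Plane × ℝ))) =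
      closure (interior (DirectedFlips.regionBetween ω Tu Tv)) ∧
    -- if the two surfaces meet only above the boundary of `conv A`, then there are no other
    -- simplices than the tetrahedra and their faces, so the tetrahedra fill the whole solid
    ((∀ x ∈ interior (convexHull ℝ (A : Set DirectedFlips.Plane)), ∀ z₁ z₂ : ℝ,
        (x, z₁) ∈ DirectedFlips.sectionGraph ω Tu → (x, z₂) ∈ DirectedFlips.sectionGraph ω Tv →
          z₁ < z₂) →
      (∀ s ∈ DirectedFlips.sweptFaces ω m T t,
        ∃ i < m, s ⊆ DirectedFlips.liftSimplex ω (t i)) ∧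
      (⋃ i ∈ Set.Iio m, convexHull ℝ
        (DirectedFlips.liftSimplex ω (t i) : Set (DirectedFlips.Plane × ℝ))) =
        DirectedFlips.regionBetween ω Tu Tv) := by
  subst hstart hend
  have h := hseq.isUpFlipSequence hlt
  have hm : 0 < m := by
    -- Without flips the two surfaces coincide, contrary to strictness.
    rcases m.eq_zero_or_pos with rfl | hm
    · exact absurd hlt.1 hlt.2
    · exact hm
  refine ⟨h.frontier_region, h.injOn_support,
    ⟨h.sweptComplex, rfl, h.isTriangulation_sweptComplex⟩, h.iUnion_support_eq, fun hint => ?_⟩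
  have hint' : ∀ x ∈ interior (convexHull ℝ (A : Set DirectedFlips.Plane)),
      DirectedFlips.height ω (T 0) x < DirectedFlips.height ω (T m) x := fun x hx =>
    hint x hx _ _
      (DirectedFlips.mem_sectionGraph_iff.2
        ⟨by rw [h.space_eq (Nat.zero_le m)]; exact interior_subset hx, rfl⟩)
      (DirectedFlips.mem_sectionGraph_iff.2
        ⟨by rw [h.space_eq le_rfl]; exact interior_subset hx, rfl⟩)
  refine ⟨fun q hq => ?_, ?_⟩
  · obtain ⟨s, rfl, ⟨i, hi, hs⟩ | ⟨i, hi, rfl⟩⟩ :=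
      DirectedFlips.IsUpFlipSequence.mem_sweptFaces.1 hq
    · obtain ⟨k, hk, hsk⟩ := h.exists_support_superset hm hint' hi hs
      exact ⟨k, hk, DirectedFlips.liftSimplex_mono hsk⟩
    · exact ⟨i, hi, Finset.Subset.rfl⟩
  -- It remains to place the bottom section inside the tetrahedra.
  · rw [h.region_eq, eq_comm, Set.union_eq_right]
    intro q hq
    obtain ⟨s, hs, hqs⟩ := DirectedFlips.mem_sectionGraph.1 hq
    obtain ⟨k, hk, hsk⟩ := h.exists_support_superset hm hint' (Nat.zero_le m) hs
    exact Set.mem_iUnion₂.2 ⟨k, hk, DirectedFlips.convexHull_liftSimplex_mono hsk hqs⟩
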